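/- \textbf{DP-Winnow.} Fix integers $d, m, K \ge 1$ and $T \ge 0$, reals $\hat\varepsilon>0$, $\eta>0$, $L$, and any fixed convention for the value $\operatorname{sgn}(0)$. Consider the following randomized online algorithm on a sequence $S=((x^{(1)},y^{(1)}),\dots,(x^{(T)},y^{(T)}))$ of examples in $\{-1,1\}^d\times\{-1,1\}$ (chosen in advance). All random draws are independent, and $\mathrm{Lap}(b)$ denotes the Laplace distribution with density $\frac{1}{2b}e^{-|x|/b}$. Initially $w=\tilde w=(\frac1d,\dots,\frac1d)$, $C=()$, $q=0$, $k=0$, and $\theta = L+\mathrm{Lap}(2/\hat\varepsilon)$ (a new instance of AboveThreshold). In each round $t=1,\dots,T$: \begin{enumerate} \item Output the hypothesis $\tilde w^{(t)} := \tilde w$. \item If $\operatorname{sgn}\langle \tilde w, x^{(t)}\rangle\neq y^{(t)}$, append $(x^{(t)},y^{(t)})$ to $C$ and increase $q$ by $1$ (so $q$ is the number of prediction errors since the last update). \item AboveThreshold test: draw $\nu\sim \mathrm{Lap}(4/\hat\varepsilon)$. If $q+\nu\ge\theta$ and $k<K$, then perform an update: \begin{itemize} \item if $C$ is non-empty and $(\hat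 x,\hat y)$ is its first element, replace $w_j$ by $\dfrac{\exp(\eta\hat y\hat x_j)}{\sum_{l=1}^d w_l\exp(\eta\hat y\hat x_l)}\,w_j$ simultaneously for all $j\in[d]$ (if $C$ is empty, $w$ is left unchanged); \item draw $j_1,\dots,j_m\in[d]$ i.i.d. with $\Pr[j_i=j]=w_j$ and set $\tilde w_j = \frac1m\,\#\{i: j_i=j\}$ for all $j$; \item set $k\leftarrow k+1$, $C\leftarrow()$, $q\leftarrow 0$, and draw a fresh $\theta= L+\mathrm{Lap}(2/\hat\varepsilon)$. \end{itemize} \end{enumerate} Let $M(S)=(\tilde w^{(1)},\dots,\tilde w^{(T)})$ be the random sequence of hypotheses that is output. \textbf{Theorem.} Let $\varepsilon,\delta\in(0,1)$. If \[\hat\varepsilon=\frac{\varepsilon}{4\sqrt{2K\log(2/\delta)}}\qquad\text{and}\qquad \eta=\frac{\varepsilon}{8\sqrt{2mK\log(2/\delta)}},\] then DP-Winnow is $(\varepsilon,\delta)$-differentially private. That is, $M(S)$ has a well-defined probability law for every $S$, and for all $S,S'$ that differ in a single example and every set $R$ of sequences of hypotheses, \[\Pr[M(S)\in R]\le e^{\varepsilon}\,\Pr[M(S')\in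 R]+\delta .\] -/

import Mathlib

open MeasureTheory

noncomputable section

/-! ### Differential privacy of an online learner -/

/-- A labelled example `(x, y)` with `x ∈ {-1, 1}^d` and `y ∈ {-1, 1}`; `ℤˣ` is the set `{-1, 1}`. -/
abbrev LabeledExample (d : ℕ) : Type := (Fin d → ℤˣ) × ℤˣ

/-- Two example sequences are neighbors if they differ in (at most) a single example. -/
def Neighboring {T : ℕ} {Z : Type*} (S S' : Fin T → Z) : Prop :=
  ∃ i, ∀ j, j ≠ i → S j = S' j

/-- `M S` is the law of the output of a randomized algorithm on the sequence `S`. The algorithm is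
`(ε, δ)`-differentially private if `Pr[M(S) ∈ R] ≤ e^ε Pr[M(S') ∈ R] + δ` for all neighboring
`S, S'` and every set `R` of outputs. -/
def IsDifferentiallyPrivate {T : ℕ} {Z Out : Type*} [MeasurableSpace Out]
    (M : (Fin T → Z) → Measure Out) (ε δ : ℝ) : Prop :=
  ∀ S S' : Fin T → Z, Neighboring S S' → ∀ R : Set Out,
    M S R ≤ ENNReal.ofReal (Real.exp ε) * M S' R + ENNReal.ofReal δ

/-! ### AboveThreshold (the sparse vector technique with Laplace noise) -/

/-- The centered Laplace distribution with scale `b`, of density `exp(-|x| / b) / (2 b)`. -/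
def laplaceMeasure (b : ℝ) : Measure ℝ :=
  volume.withDensity fun x => ENNReal.ofReal (Real.exp (-|x| / b) / (2 * b))

/-- Initializing AboveThreshold with privacy parameter `ε` and threshold `L`: the law of the noisy
threshold `L + Lap(2 / ε)`, which is the private state of the new instance. -/
def aboveThresholdInit (ε L : ℝ) : Measure ℝ :=
  (laplaceMeasure (2 / ε)).map fun ξ => L + ξ

/-- Testing a query of value `q` in an instance with noisy threshold `θ`: the law of the bit
`[q + Lap(4 / ε) ≥ θ]`. -/
def aboveThresholdTest (ε θ q : ℝ) : Measure Bool :=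
  (laplaceMeasure (4 / ε)).map fun ν => decide (θ ≤ q + ν)

/-! ### DP-Winnow -/

/-- The sign function, where `s₀` is the value that is used for `sgn 0`. -/
def signWith (s₀ r : ℝ) : ℝ := if 0 < r then 1 else if r < 0 then -1 else s₀

/-- The halfspace with weight vector `w` errs on the example `e = (x, y)`: `sgn ⟨w, x⟩ ≠ y`. -/
def HalfspaceErrs {d : ℕ} (s₀ : ℝ) (w : Fin d → ℝ) (e : LabeledExample d) : Prop :=
  signWith s₀ (∑ j, w j * ((e.1 j : ℤ) : ℝ)) ≠ ((e.2 : ℤ) : ℝ)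

/-- One multiplicative weight update of `w` with learning rate `η` on the example `e = (x, y)`. -/
def multiplicativeUpdate {d : ℕ} (η : ℝ) (w : Fin d → ℝ) (e : LabeledExample d) : Fin d → ℝ :=
  fun j => Real.exp (η * ((e.2 : ℤ) : ℝ) * ((e.1 j : ℤ) : ℝ)) /
    (∑ k, w k * Real.exp (η * ((e.2 : ℤ) : ℝ) * ((e.1 k : ℤ) : ℝ))) * w j

/-- The law on `[d]` that gives probability `w j` to `j`. -/
def indexLaw {d : ℕ} (w : Fin d → ℝ) : Measure (Fin d) :=
  ∑ j, ENNReal.ofReal (w j) • Measure.dirac j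

/-- The approximate weight vector `j ↦ (1 / m) * #{i : j_i = j}` of the sample `j_1, …, j_m`. -/
def empiricalWeights {d m : ℕ} (J : Fin m → Fin d) : Fin d → ℝ :=
  fun j => 1 / (m : ℝ) * ((Finset.univ.filter fun i => J i = j).card : ℝ)

/-- The internal state of DP-Winnow at the beginning of a round. -/
structure WinnowState (d : ℕ) where
  /-- the private weight vector `w` -/
  weights : Fin d → ℝ
  /-- the approximate weight vector, which is the hypothesis to be output -/
  hypothesis : Fin d → ℝ
  /-- the cache `C` of misclassified examples since the last update, oldest first -/
  cache : List (LabeledExample d)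
  /-- the number of prediction errors since the last update -/
  errors : ℕ
  /-- the number `k` of updates so far -/
  updates : ℕ
  /-- the noisy threshold of the current AboveThreshold instance -/
  threshold : ℝ

open Classical in
/-- The cache after the example `e` has been revealed. -/
def WinnowState.newCache {d : ℕ} (s₀ : ℝ) (s : WinnowState d) (e : LabeledExample d) :
    List (LabeledExample d) :=
  if HalfspaceErrs s₀ s.hypothesis e then s.cache ++ [e] else s.cache

open Classical in
/-- The value of the query (number of prediction errors since the last update, the current round
included) after the example `e` has been revealed. -/
def WinnowState.newErrors {d : ℕ} (s₀ : ℝ) (s : WinnowState d) (e : LabeledExample d) : ℕ :=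
  if HalfspaceErrs s₀ s.hypothesis e then s.errors + 1 else s.errors

/-- The private weights after an update with the first example of the cache `C`. The noise of
AboveThreshold can trigger an update while the cache is empty: then the weights stay the same. -/
def updatedWeights {d : ℕ} (η : ℝ) (w : Fin d → ℝ) (C : List (LabeledExample d)) : Fin d → ℝ :=
  match C with
  | [] => w
  | e :: _ => multiplicativeUpdate η w e

/-- The rounds of DP-Winnow on the remaining examples `S`, from the state `s`: the law of the
sequence of the hypotheses that are output. In each round the current hypothesis is output before
the example is used; then the error query is tested by AboveThreshold, and if the test passes and
fewer than `K` updates were made, the weights are updated, a new hypothesis is sampled from them,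
and a fresh AboveThreshold instance is started. -/
def winnowRounds {d : ℕ} (s₀ εhat η L : ℝ) (m K : ℕ) :
    (T : ℕ) → (Fin T → LabeledExample d) → WinnowState d → Measure (Fin T → Fin d → ℝ)
  | 0, _, _ => Measure.dirac Fin.elim0
  | T + 1, S, s =>
    ((aboveThresholdTest εhat s.threshold (s.newErrors s₀ (S 0) : ℝ)).bind fun above =>
      if above = true ∧ s.updates < K then
        (Measure.pi fun _ : Fin m =>
            indexLaw (updatedWeights η s.weights (s.newCache s₀ (S 0)))).bind fun J =>
          (aboveThresholdInit εhat L).bind fun θ =>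
            winnowRounds s₀ εhat η L m K T (Fin.tail S)
              { weights := updatedWeights η s.weights (s.newCache s₀ (S 0))
                hypothesis := empiricalWeights J
                cache := []
                errors := 0
                updates := s.updates + 1
                threshold := θ }
      else
        winnowRounds s₀ εhat η L m K T (Fin.tail S)
          { weights := s.weights
            hypothesis := s.hypothesis
            cache := s.newCache s₀ (S 0)
            errors := s.newErrors s₀ (S 0)
            updates := s.updates
            threshold := s.threshold }).map
      fun h => (Fin.cons s.hypothesis h : Fin (T + 1) → Fin d → ℝ)

/-- DP-Winnow with privacy parameter `εhat`, learning rate `η`, threshold `L`, sample size `m` and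
switching bound `K`: the law of the sequence of the `T` weight vectors that are output when the
(obliviously chosen) examples are `S`. It starts from the uniform weights. -/
def dpWinnow {d T : ℕ} (s₀ εhat η L : ℝ) (m K : ℕ) (S : Fin T → LabeledExample d) :
    Measure (Fin T → Fin d → ℝ) :=
  (aboveThresholdInit εhat L).bind fun θ =>
    winnowRounds s₀ εhat η L m K T S
      { weights := fun _ => 1 / (d : ℝ)
        hypothesis := fun _ => 1 / (d : ℝ)
        cache := []
        errors := 0
        updates := 0
        threshold := θ }

end

/-! ### Laplace noise -/

/-! Let `P` and `Q` be the output laws on neighboring inputs, let `t > 0` be free, and put `β = t /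
(t + 1)`. The core estimate is `P R ≤ exp εhat * tiltCost t (2η) m ^ K * (Q R) ^ β`, the form that a
bound on the Rényi divergence of order `t + 1` takes on events. Such estimates pass through the
recursion over rounds without a composition theorem: mixing over shared randomness preserves them,
by concavity of `x ^ β` (Jensen), and drawing a sample from two different weight vectors only
multiplies the constant (Hölder).

Before the differing example the two runs can be taken in the same state. In the AboveThreshold
instance that is open at this example, the error counts differ by at most one, because the
hypotheses still agree. Comparing threshold `θ` with `θ + 1` makes each failing test at least as
likely in the second run, so failing tests are free. The shift of the threshold costs `exp (εhat /
2)`, and the one passing test that closes the instance costs the same again. The update resets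
caches and counts, so afterwards only the weights differ, by factors in `[exp (-2η), exp (2η)]` up
to normalization. Later common updates preserve this relation. Hence AboveThreshold is paid for
once, not `K` times, and each of at most `K` samplings costs one `tiltCost`, which Hoeffding's lemma
controls.

The main steps are `sum_mul_rpow_exp_le`, `winnowRounds_le_of_isTiltOf` (after the affected
instance), `winnowRounds_succ_le_of_threshold_eq` (inside it) and `lintegral_winnowRounds_le`
(before it). Weighted AM-GM and a choice of `t` then give `(ε, δ)`. -/

theorem measurable_laplaceDensity (b : ℝ) :
    Measurable fun x : ℝ => ENNReal.ofReal (Real.exp (-|x| / b) / (2 * b)) := by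
  fun_prop

theorem isProbabilityMeasure_laplaceMeasure {b : ℝ} (hb : 0 < b) :
    IsProbabilityMeasure (laplaceMeasure b) := by
  have h1 : ∫ x : ℝ, Real.exp (-|x| / b) / (2 * b) = 1 := by
    rw [integral_comp_abs (f := fun x => Real.exp (-x / b) / (2 * b)), integral_div]
    have h2 : ∫ x in Set.Ioi (0 : ℝ), Real.exp (-x / b) = b := by
      have h3 := integral_exp_mul_Ioi (a := -b⁻¹) (by simpa using hb) 0
      have h4 : ∀ x : ℝ, -x / b = -b⁻¹ * x := fun x => by field_simp
      simp_rw [h4, h3]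
      simp
    rw [h2]
    field_simp
  constructor
  rw [laplaceMeasure, withDensity_apply _ MeasurableSet.univ, setLIntegral_univ,
    ← ofReal_integral_eq_lintegral_ofReal (integrable_of_integral_eq_one h1), h1,
    ENNReal.ofReal_one]
  exact Filter.Eventually.of_forall fun x => by positivity

/-- Since `|x + c| - |x| ≤ |c|`, the density at `x` is at most `exp (|c| / b)` times the density at
`x + c`; Lebesgue measure is translation invariant. -/
theorem lintegral_laplaceMeasure_comp_add_le {b : ℝ} (hb : 0 < b) (c : ℝ) {f : ℝ → ENNReal}
    (hf : Measurable f) :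
    ∫⁻ x, f (x + c) ∂laplaceMeasure b ≤
      ENNReal.ofReal (Real.exp (|c| / b)) * ∫⁻ x, f x ∂laplaceMeasure b := by
  have hρ := measurable_laplaceDensity b
  have hf' : Measurable fun x => f (x + c) := hf.comp (measurable_add_const c)
  rw [laplaceMeasure, lintegral_withDensity_eq_lintegral_mul _ hρ hf,
    lintegral_withDensity_eq_lintegral_mul _ hρ hf',
    ← lintegral_add_right_eq_self ((fun x => ENNReal.ofReal (Real.exp (-|x| / b) / (2 * b))) * f) c,
    ← lintegral_const_mul]
  · refine lintegral_mono fun x => ?_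
    simp only [Pi.mul_apply]
    rw [← mul_assoc, ← ENNReal.ofReal_mul (by positivity), ← mul_div_assoc, ← Real.exp_add]
    gcongr
    rw [← add_div]
    gcongr
    have := abs_sub_abs_le_abs_sub (x + c) x
    rw [add_sub_cancel_left] at this
    linarith
  · exact (hρ.mul hf).comp (measurable_add_const c)

/-! ### Noisy thresholds and tests of AboveThreshold -/

theorem isProbabilityMeasure_aboveThresholdInit {ε : ℝ} (hε : 0 < ε) (L : ℝ) :
    IsProbabilityMeasure (aboveThresholdInit ε L) :=
  have := isProbabilityMeasure_laplaceMeasure (b := 2 / ε) (by positivity)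
  Measure.isProbabilityMeasure_map (by fun_prop)

theorem lintegral_aboveThresholdInit_comp_add_one_le {ε : ℝ} (hε : 0 < ε) (L : ℝ)
    {f : ℝ → ENNReal} (hf : Measurable f) :
    ∫⁻ θ, f (θ + 1) ∂aboveThresholdInit ε L ≤
      ENNReal.ofReal (Real.exp (ε / 2)) * ∫⁻ θ, f θ ∂aboveThresholdInit ε L := by
  have hf' : Measurable fun x => f (x + 1) := hf.comp (measurable_add_const 1)
  rw [aboveThresholdInit, lintegral_map hf (by fun_prop), lintegral_map hf' (by fun_prop)]
  have h := lintegral_laplaceMeasure_comp_add_le (b := 2 / ε) (by positivity) 1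
    (hf.comp (measurable_const_add L))
  simpa [Function.comp_def, add_assoc] using h

theorem measurable_le_add_const (θ q : ℝ) : Measurable fun ν : ℝ => decide (θ ≤ q + ν) :=
  measurable_to_bool (by
    have : (fun ν : ℝ => decide (θ ≤ q + ν)) ⁻¹' {true} = {ν | θ ≤ q + ν} := by ext; simp
    rw [this]
    exact measurableSet_le measurable_const (by fun_prop))

theorem isProbabilityMeasure_aboveThresholdTest {ε : ℝ} (hε : 0 < ε) (θ q : ℝ) :
    IsProbabilityMeasure (aboveThresholdTest ε θ q) :=
  have := isProbabilityMeasure_laplaceMeasure (b := 4 / ε) (by positivity)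
  Measure.isProbabilityMeasure_map (measurable_le_add_const θ q).aemeasurable

theorem aboveThresholdTest_true (ε θ q : ℝ) :
    aboveThresholdTest ε θ q {true} = laplaceMeasure (4 / ε) {ν | θ ≤ q + ν} := by
  rw [aboveThresholdTest, Measure.map_apply (measurable_le_add_const θ q) (by simp)]
  congr 1
  ext
  simp

theorem aboveThresholdTest_false (ε θ q : ℝ) :
    aboveThresholdTest ε θ q {false} = laplaceMeasure (4 / ε) {ν | q + ν < θ} := by
  rw [aboveThresholdTest, Measure.map_apply (measurable_le_add_const θ q) (by simp)]
  congr 1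
  ext
  simp

theorem aboveThresholdTest_false_mono (ε : ℝ) {θ θ' q q' : ℝ} (h : θ - q ≤ θ' - q') :
    aboveThresholdTest ε θ q {false} ≤ aboveThresholdTest ε θ' q' {false} := by
  rw [aboveThresholdTest_false, aboveThresholdTest_false]
  refine measure_mono fun ν hν => ?_
  simp only [Set.mem_ofPred_eq] at *
  linarith

/-- The slack `2` covers a threshold raised by one together with an error count lowered by one; at
noise scale `4 / ε` this shift costs `exp (ε / 2)`. -/
theorem aboveThresholdTest_true_le {ε : ℝ} (hε : 0 < ε) {θ θ' q q' : ℝ}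
    (h : θ' - q' ≤ θ - q + 2) :
    aboveThresholdTest ε θ q {true} ≤
      ENNReal.ofReal (Real.exp (ε / 2)) * aboveThresholdTest ε θ' q' {true} := by
  rw [aboveThresholdTest_true, aboveThresholdTest_true]
  have hm : MeasurableSet {ν : ℝ | θ' ≤ q' + ν} := measurableSet_le measurable_const (by fun_prop)
  have h1 := lintegral_laplaceMeasure_comp_add_le (b := 4 / ε) (by positivity) 2
    (measurable_one.indicator hm : Measurable ({ν : ℝ | θ' ≤ q' + ν}.indicator 1))
  rw [lintegral_indicator_one hm] at h1
  have h2 : |(2 : ℝ)| / (4 / ε) = ε / 2 := by rw [abs_two]; field_simp; norm_num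
  rw [h2] at h1
  refine le_trans ?_ h1
  have hm' : MeasurableSet {ν : ℝ | θ ≤ q + ν} := measurableSet_le measurable_const (by fun_prop)
  rw [← lintegral_indicator_one hm']
  refine lintegral_mono fun ν => ?_
  by_cases hν : θ ≤ q + ν
  · have : θ' ≤ q' + (ν + 2) := by linarith
    simp [Set.indicator, hν, this]
  · simp [Set.indicator, hν]

theorem measurable_aboveThresholdTest (ε q : ℝ) (b : Bool) :
    Measurable fun θ => aboveThresholdTest ε θ q {b} := by
  cases b
  · exact Monotone.measurable fun θ θ' h => aboveThresholdTest_false_mono ε (by linarith)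
  · refine Antitone.measurable fun θ θ' h => ?_
    simp only [aboveThresholdTest_true]
    exact measure_mono fun ν hν => h.trans hν

/-! ### Jensen, Hölder and Hoeffding -/

theorem lintegral_rpow_le_rpow_lintegral {α : Type*} [MeasurableSpace α] (μ : Measure α)
    [IsProbabilityMeasure μ] {β : ℝ} (h0 : 0 < β) (h1 : β < 1) {f : α → ENNReal}
    (hf : AEMeasurable f μ) : ∫⁻ x, f x ^ β ∂μ ≤ (∫⁻ x, f x ∂μ) ^ β := by
  have hpq : (1 / β).HolderConjugate (1 / (1 - β)) := by
    rw [Real.holderConjugate_iff]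
    constructor
    · rw [lt_div_iff₀ h0]; linarith
    · simp
  have h := ENNReal.lintegral_mul_le_Lp_mul_Lq μ hpq (hf.pow_const β)
    (aemeasurable_const (b := (1 : ENNReal)))
  simpa [← ENNReal.rpow_mul, h0.ne'] using h

/-- Hölder with exponents `t + 1` and `(t + 1) / t`, applied to `P r g ^ β = (P ^ (1 / (t + 1)) r) *
(P g) ^ β`. It is a change of measure from `P r` to `P`, paid for by the moment of order `t + 1` of
the density `r`. -/
theorem sum_mul_rpow_le {ι : Type*} [Fintype ι] {P r : ι → ℝ} (hP : ∀ i, 0 < P i)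
    (hr : ∀ i, 0 < r i) {t B : ℝ} (ht : 0 < t) (hB : ∑ i, P i * r i ^ (t + 1) ≤ B)
    (g : ι → ENNReal) :
    ∑ i, ENNReal.ofReal (P i * r i) * g i ^ (t / (t + 1)) ≤
      ENNReal.ofReal B ^ (1 / (t + 1)) * (∑ i, ENNReal.ofReal (P i) * g i) ^ (t / (t + 1)) := by
  have ht1 : 0 < t + 1 := by linarith
  have hpq : (t + 1).HolderConjugate ((t + 1) / t) := by
    rw [Real.holderConjugate_iff]
    constructor
    · linarith
    · field_simp
      ring
  have h := ENNReal.inner_le_Lp_mul_Lq Finset.univ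
    (fun i => ENNReal.ofReal (P i) ^ (1 / (t + 1)) * ENNReal.ofReal (r i))
    (fun i => (ENNReal.ofReal (P i) * g i) ^ (t / (t + 1))) hpq
  have e1 : ∀ i, (ENNReal.ofReal (P i) ^ (1 / (t + 1)) * ENNReal.ofReal (r i)) *
      (ENNReal.ofReal (P i) * g i) ^ (t / (t + 1)) =
      ENNReal.ofReal (P i * r i) * g i ^ (t / (t + 1)) := fun i => by
    have e : ENNReal.ofReal (P i) ^ (1 / (t + 1)) * ENNReal.ofReal (P i) ^ (t / (t + 1)) =
        ENNReal.ofReal (P i) := by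
      rw [← ENNReal.rpow_add _ _ (by simpa using hP i) (by simp), ← add_div, add_comm 1 t,
        div_self ht1.ne', ENNReal.rpow_one]
    rw [ENNReal.mul_rpow_of_nonneg _ _ (by positivity), ENNReal.ofReal_mul (hP i).le]
    calc _ = (ENNReal.ofReal (P i) ^ (1 / (t + 1)) * ENNReal.ofReal (P i) ^ (t / (t + 1))) *
          ENNReal.ofReal (r i) * g i ^ (t / (t + 1)) := by ring
      _ = _ := by rw [e]
  have e2 : ∀ i, (ENNReal.ofReal (P i) ^ (1 / (t + 1)) * ENNReal.ofReal (r i)) ^ (t + 1) =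
      ENNReal.ofReal (P i * r i ^ (t + 1)) := fun i => by
    rw [ENNReal.mul_rpow_of_nonneg _ _ ht1.le, ← ENNReal.rpow_mul, one_div,
      inv_mul_cancel₀ ht1.ne', ENNReal.rpow_one, ENNReal.ofReal_rpow_of_pos (hr i),
      ENNReal.ofReal_mul (hP i).le]
  have e3 : ∀ i, ((ENNReal.ofReal (P i) * g i) ^ (t / (t + 1))) ^ ((t + 1) / t) =
      ENNReal.ofReal (P i) * g i := fun i => by
    rw [← ENNReal.rpow_mul, div_mul_div_cancel₀ ht1.ne', div_self ht.ne', ENNReal.rpow_one]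
  simp only [e1, e2, e3, one_div_div] at h
  refine h.trans ?_
  gcongr
  rw [← ENNReal.ofReal_sum_of_nonneg fun i _ =>
    mul_nonneg (hP i).le (Real.rpow_nonneg (hr i).le _)]
  exact ENNReal.ofReal_le_ofReal hB

/-! ### Index laws and the Rényi moment of a tilt -/

theorem isProbabilityMeasure_indexLaw {d : ℕ} {w : Fin d → ℝ} (hw : ∀ j, 0 < w j)
    (hw1 : ∑ j, w j = 1) : IsProbabilityMeasure (indexLaw w) := by
  constructor
  simp only [indexLaw, Measure.coe_finsetSum, Measure.coe_smul, Finset.sum_apply, Pi.smul_apply,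
    measure_univ, smul_eq_mul, mul_one]
  rw [← ENNReal.ofReal_sum_of_nonneg fun j _ => (hw j).le, hw1, ENNReal.ofReal_one]

theorem indexLaw_singleton {d : ℕ} (w : Fin d → ℝ) (j : Fin d) :
    indexLaw w {j} = ENNReal.ofReal (w j) := by
  simp [indexLaw, Set.indicator, Finset.sum_ite_eq']

theorem integral_indexLaw {d : ℕ} {w : Fin d → ℝ} (hw : ∀ j, 0 < w j)
    (hw1 : ∑ j, w j = 1) (f : Fin d → ℝ) : ∫ j, f j ∂indexLaw w = ∑ j, w j * f j := by
  have := isProbabilityMeasure_indexLaw hw hw1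
  rw [integral_fintype .of_finite]
  simp [Measure.real, indexLaw_singleton, ENNReal.toReal_ofReal (hw _).le]

/-- A Rényi divergence bound for exponential tilting by a bounded function. -/
theorem sum_mul_rpow_exp_le {d : ℕ} {w w' Δ : Fin d → ℝ} {c a t : ℝ} (hw : ∀ j, 0 < w j)
    (hw1 : ∑ j, w j = 1) (hw1' : ∑ j, w' j = 1) (hc : 0 < c)
    (hΔ : ∀ j, |Δ j| ≤ a) (ht : 0 < t)
    (h : ∀ j, w j = w' j * (c * Real.exp (Δ j))) :
    ∑ j, w' j * (c * Real.exp (Δ j)) ^ (t + 1) ≤ Real.exp (t * (t + 1) * a ^ 2 / 2) := by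
  have := isProbabilityMeasure_indexLaw hw hw1
  have hs := ProbabilityTheory.hasSubgaussianMGF_of_mem_Icc (X := Δ) (μ := indexLaw w)
    (a := -a) (b := a) measurable_from_top.aemeasurable
    (Filter.Eventually.of_forall fun j => abs_le.1 (hΔ j))
  set M := ∫ j, Δ j ∂indexLaw w with hM
  have hsq : (((‖a - -a‖₊ / 2) ^ 2 : NNReal) : ℝ) = a ^ 2 := by
    push_cast
    rw [div_pow, Real.norm_eq_abs, sq_abs]
    ring
  -- Hoeffding's lemma for `Δ` under `w`. It is used twice: at `u = t` for the moment itself and at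
  -- `u = -1` for the normalizing constant `c`.
  have key : ∀ u : ℝ, ∑ j, w j * Real.exp (u * (Δ j - M)) ≤ Real.exp (a ^ 2 * u ^ 2 / 2) := by
    intro u
    have := hs.mgf_le u
    rwa [ProbabilityTheory.mgf, integral_indexLaw hw hw1, hsq] at this
  -- Summing `w' j = w j * exp (-Δ j) / c` to one identifies `c` as the `w`-mean of `exp (-Δ)`.
  have hcM : c = (∑ j, w j * Real.exp (-1 * (Δ j - M))) * Real.exp (-M) := by
    have : ∀ j, w j * Real.exp (-1 * (Δ j - M)) = w' j * (c * Real.exp M) := fun j => by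
      rw [h j, mul_assoc, mul_assoc, ← Real.exp_add]
      congr 3
      ring
    simp_rw [this]
    rw [← Finset.sum_mul, hw1', one_mul, mul_assoc, ← Real.exp_add, add_neg_cancel, Real.exp_zero,
      mul_one]
  have hc2 : c ≤ Real.exp (a ^ 2 / 2) * Real.exp (-M) := by
    rw [hcM]
    gcongr
    simpa using key (-1)
  calc ∑ j, w' j * (c * Real.exp (Δ j)) ^ (t + 1)
      = c ^ t * Real.exp (t * M) * ∑ j, w j * Real.exp (t * (Δ j - M)) := by
        rw [Finset.mul_sum]
        refine Finset.sum_congr rfl fun j _ => ?_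
        have hp : 0 < c * Real.exp (Δ j) := by positivity
        rw [Real.rpow_add hp, Real.rpow_one, mul_comm (_ ^ t), ← mul_assoc, ← h j,
          Real.mul_rpow hc.le (Real.exp_pos _).le, ← Real.exp_mul]
        have : Real.exp (Δ j * t) = Real.exp (t * M) * Real.exp (t * (Δ j - M)) := by
          rw [← Real.exp_add]; congr 1; ring
        rw [this]; ring
    _ ≤ (Real.exp (a ^ 2 / 2) * Real.exp (-M)) ^ t * Real.exp (t * M) *
          Real.exp (a ^ 2 * t ^ 2 / 2) := by
        gcongr
        · exact Finset.sum_nonneg fun j _ => mul_nonneg (hw j).le (Real.exp_pos _).le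
        · exact key t
    _ = _ := by
        rw [Real.mul_rpow (Real.exp_pos _).le (Real.exp_pos _).le, ← Real.exp_mul, ← Real.exp_mul,
          ← Real.exp_add, ← Real.exp_add, ← Real.exp_add]
        congr 1
        ring

/-! ### One round of DP-Winnow -/

/-- A weight vector with positive entries that sum to one. -/
structure IsPositiveWeights {d : ℕ} (w : Fin d → ℝ) : Prop where
  pos : ∀ j, 0 < w j
  sum_eq_one : ∑ j, w j = 1

theorem IsPositiveWeights.sum_mul_exp_pos {d : ℕ} {w : Fin d → ℝ} (hw : IsPositiveWeights w)
    (f : Fin d → ℝ) : 0 < ∑ k, w k * Real.exp (f k) := by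
  refine Finset.sum_pos (fun k _ => mul_pos (hw.pos k) (Real.exp_pos _)) ?_
  by_contra h
  have := hw.sum_eq_one
  simp [Finset.not_nonempty_iff_eq_empty.1 h] at this

theorem IsPositiveWeights.multiplicativeUpdate {d : ℕ} {w : Fin d → ℝ} (hw : IsPositiveWeights w)
    (η : ℝ) (e : LabeledExample d) : IsPositiveWeights (multiplicativeUpdate η w e) := by
  have hZ := hw.sum_mul_exp_pos fun k => η * ((e.2 : ℤ) : ℝ) * ((e.1 k : ℤ) : ℝ)
  refine ⟨fun j => mul_pos (div_pos (Real.exp_pos _) hZ) (hw.pos j), ?_⟩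
  simp only [_root_.multiplicativeUpdate, div_mul_eq_mul_div]
  rw [← Finset.sum_div, div_eq_one_iff_eq hZ.ne']
  exact Finset.sum_congr rfl fun j _ => mul_comm _ _

theorem IsPositiveWeights.updatedWeights {d : ℕ} {w : Fin d → ℝ} (hw : IsPositiveWeights w)
    (η : ℝ) (C : List (LabeledExample d)) : IsPositiveWeights (updatedWeights η w C) := by
  cases C with
  | nil => exact hw
  | cons e C => exact hw.multiplicativeUpdate η e

/-- The state after a round without an update. -/
noncomputable def WinnowState.skip {d : ℕ} (s₀ : ℝ) (s : WinnowState d) (e : LabeledExample d) :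
    WinnowState d where
  weights := s.weights
  hypothesis := s.hypothesis
  cache := s.newCache s₀ e
  errors := s.newErrors s₀ e
  updates := s.updates
  threshold := s.threshold

/-- The state after a round with an update, for the sample `J` and the new threshold `θ`. -/
noncomputable def WinnowState.update {d m : ℕ} (s₀ η : ℝ) (s : WinnowState d) (e : LabeledExample d)
    (J : Fin m → Fin d) (θ : ℝ) : WinnowState d where
  weights := updatedWeights η s.weights (s.newCache s₀ e)
  hypothesis := empiricalWeights J
  cache := []
  errors := 0
  updates := s.updates + 1
  threshold := θ

/-- The law of the remaining hypotheses if an update is made in the current round. -/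
noncomputable def winnowUpdateLaw {d : ℕ} (s₀ εhat η L : ℝ) (m K T : ℕ) (S : Fin (T + 1) → LabeledExample d)
    (s : WinnowState d) : Measure (Fin T → Fin d → ℝ) :=
  (Measure.pi fun _ : Fin m =>
      indexLaw (updatedWeights η s.weights (s.newCache s₀ (S 0)))).bind fun J =>
    (aboveThresholdInit εhat L).bind fun θ =>
      winnowRounds s₀ εhat η L m K T (Fin.tail S) (s.update s₀ η (S 0) J θ)

/-- Putting the hypothesis `h₀` in front of a sequence of hypotheses. -/
def prependHypothesis {d T : ℕ} (h₀ : Fin d → ℝ) (h : Fin T → Fin d → ℝ) :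
    Fin (T + 1) → Fin d → ℝ :=
  Fin.cons h₀ h

theorem measurable_prependHypothesis {d T : ℕ} (h₀ : Fin d → ℝ) :
    Measurable (prependHypothesis h₀ : (Fin T → Fin d → ℝ) → _) := by
  refine measurable_pi_lambda _ fun i => ?_
  refine Fin.cases ?_ (fun i => ?_) i
  · simp [prependHypothesis]
  · simpa [prependHypothesis] using measurable_pi_apply i

theorem winnowRounds_succ_apply {d : ℕ} (s₀ εhat η L : ℝ) (m K T : ℕ)
    (S : Fin (T + 1) → LabeledExample d) (s : WinnowState d)
    {R : Set (Fin (T + 1) → Fin d → ℝ)} (hR : MeasurableSet R) :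
    winnowRounds s₀ εhat η L m K (T + 1) S s R =
      aboveThresholdTest εhat s.threshold (s.newErrors s₀ (S 0)) {true} *
        (if s.updates < K then winnowUpdateLaw s₀ εhat η L m K T S s
          else winnowRounds s₀ εhat η L m K T (Fin.tail S) (s.skip s₀ (S 0)))
          (prependHypothesis s.hypothesis ⁻¹' R) +
      aboveThresholdTest εhat s.threshold (s.newErrors s₀ (S 0)) {false} *
        winnowRounds s₀ εhat η L m K T (Fin.tail S) (s.skip s₀ (S 0))
          (prependHypothesis s.hypothesis ⁻¹' R) := by
  have hR' := measurable_prependHypothesis s.hypothesis hR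
  rw [winnowRounds]
  change Measure.map (prependHypothesis s.hypothesis) _ R = _
  rw [Measure.map_apply (measurable_prependHypothesis _) hR,
    Measure.bind_apply hR' measurable_from_top.aemeasurable, lintegral_fintype, Fintype.sum_bool]
  simp only [true_and, Bool.false_eq_true, false_and, if_false, mul_comm]
  rfl

/-- Needed to evaluate the `bind` over a fresh threshold. The threshold enters a round only through
the test probabilities, which are monotone in it, and through the run that continues without an
update; an update discards it. -/
theorem measurable_winnowRounds_threshold {d : ℕ} (s₀ εhat η L : ℝ) (m K T : ℕ)
    (S : Fin T → LabeledExample d) (s : ℝ → WinnowState d)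
    (hs : ∀ θ, s θ = { s 0 with threshold := θ }) :
    Measurable fun θ => winnowRounds s₀ εhat η L m K T S (s θ) := by
  induction T generalizing s with
  | zero => simpa only [winnowRounds] using measurable_const
  | succ T ih =>
    refine Measure.measurable_of_measurable_coe _ fun R hR => ?_
    have hR' := measurable_prependHypothesis (s 0).hypothesis hR
    have hN : Measurable fun θ => winnowRounds s₀ εhat η L m K T (Fin.tail S)
        ((s θ).skip s₀ (S 0)) (prependHypothesis (s 0).hypothesis ⁻¹' R) :=
      (Measure.measurable_coe hR').comp (ih (Fin.tail S) (fun θ => (s θ).skip s₀ (S 0))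
        fun θ => by rw [hs θ]; rfl)
    have e : ∀ θ, winnowRounds s₀ εhat η L m K (T + 1) S (s θ) R =
        aboveThresholdTest εhat θ ((s 0).newErrors s₀ (S 0)) {true} *
          (if (s 0).updates < K then winnowUpdateLaw s₀ εhat η L m K T S (s 0)
              (prependHypothesis (s 0).hypothesis ⁻¹' R)
            else winnowRounds s₀ εhat η L m K T (Fin.tail S) ((s θ).skip s₀ (S 0))
              (prependHypothesis (s 0).hypothesis ⁻¹' R)) +
        aboveThresholdTest εhat θ ((s 0).newErrors s₀ (S 0)) {false} *
          winnowRounds s₀ εhat η L m K T (Fin.tail S) ((s θ).skip s₀ (S 0))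
            (prependHypothesis (s 0).hypothesis ⁻¹' R) := fun θ => by
      rw [winnowRounds_succ_apply _ _ _ _ _ _ _ _ _ hR, hs θ]
      congr 2
      split_ifs <;> rfl
    simp_rw [e]
    refine ((measurable_aboveThresholdTest _ _ _).mul ?_).add
      ((measurable_aboveThresholdTest _ _ _).mul hN)
    split_ifs
    · exact measurable_const
    · exact hN

theorem pi_indexLaw_singleton {d m : ℕ} {w : Fin d → ℝ} (hw : IsPositiveWeights w)
    (J : Fin m → Fin d) :
    (Measure.pi fun _ : Fin m => indexLaw w) {J} = ENNReal.ofReal (∏ i, w (J i)) := by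
  have := isProbabilityMeasure_indexLaw hw.pos hw.sum_eq_one
  rw [Measure.pi_singleton, ENNReal.ofReal_prod_of_nonneg fun i _ => (hw.pos _).le]
  simp only [indexLaw_singleton]

theorem winnowUpdateLaw_apply {d : ℕ} (s₀ εhat η L : ℝ) (m K T : ℕ)
    (S : Fin (T + 1) → LabeledExample d) {s : WinnowState d} (hs : IsPositiveWeights s.weights)
    {R : Set (Fin T → Fin d → ℝ)} (hR : MeasurableSet R) :
    winnowUpdateLaw s₀ εhat η L m K T S s R =
      ∑ J : Fin m → Fin d,
        ENNReal.ofReal (∏ i, updatedWeights η s.weights (s.newCache s₀ (S 0)) (J i)) *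
          ∫⁻ θ, winnowRounds s₀ εhat η L m K T (Fin.tail S) (s.update s₀ η (S 0) J θ) R
            ∂aboveThresholdInit εhat L := by
  rw [winnowUpdateLaw, Measure.bind_apply hR (measurable_of_countable _).aemeasurable,
    lintegral_fintype]
  refine Finset.sum_congr rfl fun J _ => ?_
  rw [pi_indexLaw_singleton (hs.updatedWeights η _), mul_comm, Measure.bind_apply hR]
  exact (measurable_winnowRounds_threshold _ _ _ _ _ _ _ _ _ fun θ => rfl).aemeasurable

theorem isProbabilityMeasure_winnowRounds {d : ℕ} (s₀ η L : ℝ) {εhat : ℝ} (hε : 0 < εhat)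
    (m K T : ℕ) (S : Fin T → LabeledExample d) {s : WinnowState d}
    (hs : IsPositiveWeights s.weights) :
    IsProbabilityMeasure (winnowRounds s₀ εhat η L m K T S s) := by
  induction T generalizing s with
  | zero => rw [winnowRounds]; infer_instance
  | succ T ih =>
    have := isProbabilityMeasure_aboveThresholdTest hε s.threshold (s.newErrors s₀ (S 0))
    have := isProbabilityMeasure_aboveThresholdInit hε L
    have hw := hs.updatedWeights η (s.newCache s₀ (S 0))
    have := isProbabilityMeasure_indexLaw hw.pos hw.sum_eq_one
    rw [winnowRounds]
    change IsProbabilityMeasure (Measure.map (prependHypothesis s.hypothesis) _)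
    refine @Measure.isProbabilityMeasure_map _ _ _ _ _ ?_ _ (measurable_prependHypothesis _).aemeasurable
    refine isProbabilityMeasure_bind measurable_from_top.aemeasurable
      (Filter.Eventually.of_forall fun b => ?_)
    split_ifs
    · refine isProbabilityMeasure_bind (measurable_of_countable _).aemeasurable
        (Filter.Eventually.of_forall fun J => ?_)
      refine isProbabilityMeasure_bind
        (measurable_winnowRounds_threshold _ _ _ _ _ _ _ _
          (s.update s₀ η (S 0) J) fun θ => rfl).aemeasurable
        (Filter.Eventually.of_forall fun θ => ?_)
      exact ih _ hw
    · exact ih _ hs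

/-! ### Tilted weight vectors -/

/-- Up to normalization, `w` arises from `w'` by multiplying each entry with a factor in
`[exp (-a), exp a]`. -/
def IsTiltOf {d : ℕ} (a : ℝ) (w w' : Fin d → ℝ) : Prop :=
  ∃ (Δ : Fin d → ℝ) (c : ℝ), 0 < c ∧ (∀ j, |Δ j| ≤ a) ∧ ∀ j, w j = w' j * (c * Real.exp (Δ j))

theorem exists_updatedWeights_eq {d : ℕ} {w : Fin d → ℝ} (hw : IsPositiveWeights w) (η : ℝ)
    (C : List (LabeledExample d)) :
    ∃ (σ : Fin d → ℝ) (c : ℝ), 0 < c ∧ (∀ j, |σ j| ≤ |η|) ∧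
      ∀ j, updatedWeights η w C j = w j * (c * Real.exp (σ j)) := by
  cases C with
  | nil => exact ⟨0, 1, one_pos, fun j => by simp, fun j => by simp [updatedWeights]⟩
  | cons e C =>
    refine ⟨fun j => η * ((e.2 : ℤ) : ℝ) * ((e.1 j : ℤ) : ℝ),
      (∑ k, w k * Real.exp (η * ((e.2 : ℤ) : ℝ) * ((e.1 k : ℤ) : ℝ)))⁻¹, ?_, fun j => ?_,
      fun j => ?_⟩
    · exact inv_pos.2 (hw.sum_mul_exp_pos _)
    · have h1 : ∀ u : ℤˣ, |((u : ℤ) : ℝ)| = 1 := fun u => by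
        rcases Int.units_eq_one_or u with h | h <;> simp [h]
      rw [abs_mul, abs_mul, h1, h1, mul_one, mul_one]
    · simp only [updatedWeights, multiplicativeUpdate]
      rw [div_eq_mul_inv]
      ring

/-- Each cache, empty or not, changes a weight by a factor in `[exp (-η), exp η]` up to
normalization, so the quotient of two updates involves at most `2η`. No relation between the caches
is needed. -/
theorem isTiltOf_updatedWeights {d : ℕ} {w : Fin d → ℝ} (hw : IsPositiveWeights w) {η : ℝ}
    (hη : 0 ≤ η) (C C' : List (LabeledExample d)) :
    IsTiltOf (2 * η) (updatedWeights η w C) (updatedWeights η w C') := by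
  obtain ⟨σ, c, hc, hσ, h⟩ := exists_updatedWeights_eq hw η C
  obtain ⟨σ', c', hc', hσ', h'⟩ := exists_updatedWeights_eq hw η C'
  rw [abs_of_nonneg hη] at hσ hσ'
  refine ⟨fun j => σ j - σ' j, c / c', by positivity, fun j => ?_, fun j => ?_⟩
  · linarith [abs_sub (σ j) (σ' j), hσ j, hσ' j]
  · rw [h, h', Real.exp_sub]
    field_simp

/-- The common exponential factor cancels in the quotient, and the two normalizations only alter
`c`. Thus the tilt does not grow over later updates. -/
theorem IsTiltOf.updatedWeights {d : ℕ} {a : ℝ} {w w' : Fin d → ℝ} (h : IsTiltOf a w w')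
    (hw : IsPositiveWeights w) (hw' : IsPositiveWeights w') (η : ℝ)
    (C : List (LabeledExample d)) :
    IsTiltOf a (updatedWeights η w C) (updatedWeights η w' C) := by
  cases C with
  | nil => exact h
  | cons e C =>
    obtain ⟨Δ, c, hc, hΔ, h⟩ := h
    have h1 := hw.sum_mul_exp_pos fun k => η * ((e.2 : ℤ) : ℝ) * ((e.1 k : ℤ) : ℝ)
    have h2 := hw'.sum_mul_exp_pos fun k => η * ((e.2 : ℤ) : ℝ) * ((e.1 k : ℤ) : ℝ)
    refine ⟨Δ, c * (∑ k, w' k * Real.exp (η * ((e.2 : ℤ) : ℝ) * ((e.1 k : ℤ) : ℝ))) /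
      (∑ k, w k * Real.exp (η * ((e.2 : ℤ) : ℝ) * ((e.1 k : ℤ) : ℝ))), by positivity, hΔ,
      fun j => ?_⟩
    simp only [_root_.updatedWeights, multiplicativeUpdate]
    generalize (∑ k, w k * Real.exp (η * ((e.2 : ℤ) : ℝ) * ((e.1 k : ℤ) : ℝ))) = Z at *
    generalize (∑ k, w' k * Real.exp (η * ((e.2 : ℤ) : ℝ) * ((e.1 k : ℤ) : ℝ))) = Z' at *
    rw [h j]
    field_simp

/-- The cost of drawing `m` indices from tilted weights, in the Hölder bounds with exponent
`t / (t + 1)`. -/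
noncomputable def tiltCost (t a : ℝ) (m : ℕ) : ENNReal :=
  ENNReal.ofReal (Real.exp (t * (t + 1) * a ^ 2 / 2) ^ m) ^ (1 / (t + 1))

theorem one_le_tiltCost {t : ℝ} (ht : 0 < t) (a : ℝ) (m : ℕ) : 1 ≤ tiltCost t a m := by
  refine ENNReal.one_le_rpow ?_ (by positivity)
  rw [ENNReal.one_le_ofReal]
  exact one_le_pow₀ (Real.one_le_exp (by positivity))

/-- The density of the product law factors, so its moment of order `t + 1` is the `m`-th power of
the moment for one index. -/
theorem IsTiltOf.sum_prod_mul_rpow_le {d m : ℕ} {a t : ℝ} {w w' : Fin d → ℝ}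
    (h : IsTiltOf a w w') (hw : IsPositiveWeights w) (hw' : IsPositiveWeights w') (ht : 0 < t)
    (g : (Fin m → Fin d) → ENNReal) :
    ∑ J, ENNReal.ofReal (∏ i, w (J i)) * g J ^ (t / (t + 1)) ≤
      tiltCost t a m * (∑ J, ENNReal.ofReal (∏ i, w' (J i)) * g J) ^ (t / (t + 1)) := by
  obtain ⟨Δ, c, hc, hΔ, h⟩ := h
  have hr : ∀ j, 0 < c * Real.exp (Δ j) := fun j => mul_pos hc (Real.exp_pos _)
  have key := sum_mul_rpow_le (P := fun J : Fin m → Fin d => ∏ i, w' (J i))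
    (r := fun J => ∏ i, c * Real.exp (Δ (J i))) (fun J => Finset.prod_pos fun i _ => hw'.pos _)
    (fun J => Finset.prod_pos fun i _ => hr _) ht
    (B := Real.exp (t * (t + 1) * a ^ 2 / 2) ^ m) ?_ g
  · simp only [← Finset.prod_mul_distrib, ← h] at key
    exact key
  · have e : ∀ J : Fin m → Fin d, (∏ i, w' (J i)) * (∏ i, c * Real.exp (Δ (J i))) ^ (t + 1) =
        ∏ i, w' (J i) * (c * Real.exp (Δ (J i))) ^ (t + 1) := fun J => by
      rw [← Real.finsetProd_rpow _ _ fun i _ => (hr _).le, Finset.prod_mul_distrib]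
    simp only [e]
    rw [← Fintype.sum_pow (fun j => w' j * (c * Real.exp (Δ j)) ^ (t + 1)) m]
    gcongr
    · exact Finset.sum_nonneg fun j _ => mul_nonneg (hw'.pos j).le (Real.rpow_nonneg (hr j).le _)
    · exact sum_mul_rpow_exp_le hw.pos hw.sum_eq_one hw'.sum_eq_one hc hΔ ht h

/-! ### Comparison of two runs -/

theorem bool_mul_rpow_le (μ : Measure Bool) [IsProbabilityMeasure μ] {β : ℝ} (h0 : 0 < β)
    (h1 : β < 1) (x y : ENNReal) :
    μ {true} * x ^ β + μ {false} * y ^ β ≤ (μ {true} * x + μ {false} * y) ^ β := by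
  have h := lintegral_rpow_le_rpow_lintegral μ h0 h1 (f := fun b => cond b x y)
    measurable_from_top.aemeasurable
  simpa [lintegral_fintype, mul_comm] using h

theorem bool_measure_true_add_false (μ : Measure Bool) [IsProbabilityMeasure μ] :
    μ {true} + μ {false} = 1 := by
  rw [← prob_add_prob_compl (μ := μ) (s := {true}) (by simp)]
  congr 2
  ext b
  cases b <;> simp

section Comparison

variable {d : ℕ} {s₀ εhat η L : ℝ} {m K : ℕ} {t : ℝ}

/-! ### Unfolding one round and passing power bounds through it -/

theorem winnowRounds_succ_of_lt {T : ℕ} {S : Fin (T + 1) → LabeledExample d} {s : WinnowState d}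
    (hk : s.updates < K) {R : Set (Fin (T + 1) → Fin d → ℝ)} (hR : MeasurableSet R) :
    winnowRounds s₀ εhat η L m K (T + 1) S s R =
      aboveThresholdTest εhat s.threshold (s.newErrors s₀ (S 0)) {true} *
        winnowUpdateLaw s₀ εhat η L m K T S s (prependHypothesis s.hypothesis ⁻¹' R) +
      aboveThresholdTest εhat s.threshold (s.newErrors s₀ (S 0)) {false} *
        winnowRounds s₀ εhat η L m K T (Fin.tail S) (s.skip s₀ (S 0))
          (prependHypothesis s.hypothesis ⁻¹' R) := by
  rw [winnowRounds_succ_apply _ _ _ _ _ _ _ _ _ hR, if_pos hk]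

theorem winnowRounds_succ_of_le (hε : 0 < εhat) {T : ℕ} {S : Fin (T + 1) → LabeledExample d}
    {s : WinnowState d} (hk : K ≤ s.updates) {R : Set (Fin (T + 1) → Fin d → ℝ)}
    (hR : MeasurableSet R) :
    winnowRounds s₀ εhat η L m K (T + 1) S s R =
      winnowRounds s₀ εhat η L m K T (Fin.tail S) (s.skip s₀ (S 0))
        (prependHypothesis s.hypothesis ⁻¹' R) := by
  have := isProbabilityMeasure_aboveThresholdTest hε s.threshold (s.newErrors s₀ (S 0))
  rw [winnowRounds_succ_apply _ _ _ _ _ _ _ _ _ hR, if_neg hk.not_gt, ← add_mul,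
    bool_measure_true_add_false, one_mul]

theorem winnowUpdateLaw_le (ht : 0 < t) {T : ℕ} {S S' : Fin (T + 1) → LabeledExample d}
    {s s' : WinnowState d} (hs : IsPositiveWeights s.weights) (hs' : IsPositiveWeights s'.weights)
    (htilt : IsTiltOf (2 * η) (updatedWeights η s.weights (s.newCache s₀ (S 0)))
      (updatedWeights η s'.weights (s'.newCache s₀ (S' 0))))
    {R : Set (Fin T → Fin d → ℝ)} (hR : MeasurableSet R) {c : ENNReal}
    (ih : ∀ J : Fin m → Fin d,
      ∫⁻ θ, winnowRounds s₀ εhat η L m K T (Fin.tail S) (s.update s₀ η (S 0) J θ) R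
          ∂aboveThresholdInit εhat L ≤
        c * (∫⁻ θ, winnowRounds s₀ εhat η L m K T (Fin.tail S') (s'.update s₀ η (S' 0) J θ) R
          ∂aboveThresholdInit εhat L) ^ (t / (t + 1))) :
    winnowUpdateLaw s₀ εhat η L m K T S s R ≤
      c * tiltCost t (2 * η) m * winnowUpdateLaw s₀ εhat η L m K T S' s' R ^ (t / (t + 1)) := by
  rw [winnowUpdateLaw_apply _ _ _ _ _ _ _ _ hs hR, winnowUpdateLaw_apply _ _ _ _ _ _ _ _ hs' hR,
    mul_assoc]
  refine (Finset.sum_le_sum fun J _ => mul_le_mul_right (ih J) _).trans ?_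
  simp only [mul_left_comm _ c]
  rw [← Finset.mul_sum]
  gcongr
  exact htilt.sum_prod_mul_rpow_le (hs.updatedWeights η _) (hs'.updatedWeights η _) ht _

theorem div_add_one_mem_Ioo (ht : 0 < t) : t / (t + 1) ∈ Set.Ioo (0 : ℝ) 1 :=
  ⟨by positivity, by rw [div_lt_one (by positivity)]; linarith⟩

theorem measurable_winnowRounds_update {T : ℕ} (S : Fin T → LabeledExample d) (s : WinnowState d)
    (e : LabeledExample d) (J : Fin m → Fin d) {R : Set (Fin T → Fin d → ℝ)}
    (hR : MeasurableSet R) :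
    Measurable fun θ => winnowRounds s₀ εhat η L m K T S (s.update s₀ η e J θ) R :=
  (Measure.measurable_coe hR).comp (measurable_winnowRounds_threshold _ _ _ _ _ _ _ _ _ fun _ => rfl)

theorem measurable_winnowRounds_apply {T : ℕ} (S : Fin T → LabeledExample d) (s : WinnowState d)
    {R : Set (Fin T → Fin d → ℝ)} (hR : MeasurableSet R) :
    Measurable fun θ => winnowRounds s₀ εhat η L m K T S { s with threshold := θ } R :=
  (Measure.measurable_coe hR).comp (measurable_winnowRounds_threshold _ _ _ _ _ _ _ _ _ fun _ => rfl)

theorem lintegral_le_of_forall_le_rpow (ht : 0 < t) (hε : 0 < εhat) {f g : ℝ → ENNReal}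
    (hg : Measurable g) {c : ENNReal} (h : ∀ θ, f θ ≤ c * g θ ^ (t / (t + 1))) :
    ∫⁻ θ, f θ ∂aboveThresholdInit εhat L ≤
      c * (∫⁻ θ, g θ ∂aboveThresholdInit εhat L) ^ (t / (t + 1)) := by
  have := isProbabilityMeasure_aboveThresholdInit hε L
  refine (lintegral_mono h).trans ?_
  rw [lintegral_const_mul _ (hg.pow_const _)]
  gcongr
  exact lintegral_rpow_le_rpow_lintegral _ (div_add_one_mem_Ioo ht).1 (div_add_one_mem_Ioo ht).2
    hg.aemeasurable

/-- This treats the rounds after the affected instance. The tests have the same law in both runs and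
are absorbed by Jensen; only the remaining `K - s.updates` samplings are charged. -/
theorem winnowRounds_le_of_isTiltOf (ht : 0 < t) (hε : 0 < εhat) {T : ℕ}
    (S : Fin T → LabeledExample d) {s : WinnowState d} {w' : Fin d → ℝ}
    (hs : IsPositiveWeights s.weights) (hw' : IsPositiveWeights w')
    (htilt : IsTiltOf (2 * η) s.weights w') {R : Set (Fin T → Fin d → ℝ)}
    (hR : MeasurableSet R) :
    winnowRounds s₀ εhat η L m K T S s R ≤ tiltCost t (2 * η) m ^ (K - s.updates) *
      winnowRounds s₀ εhat η L m K T S { s with weights := w' } R ^ (t / (t + 1)) := by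
  induction T generalizing s w' with
  | zero =>
    have h1 := one_le_tiltCost ht (2 * η) m
    simp only [winnowRounds, Measure.dirac_apply' _ hR, Set.indicator]
    split_ifs
    · simpa using one_le_pow₀ h1
    · simp
  | succ T ih =>
    obtain ⟨h0, h1⟩ := div_add_one_mem_Ioo ht
    set s' : WinnowState d := { s with weights := w' } with hs'
    have hR' := measurable_prependHypothesis s.hypothesis hR
    have hN : winnowRounds s₀ εhat η L m K T (Fin.tail S) (s.skip s₀ (S 0)) _ ≤
        tiltCost t (2 * η) m ^ (K - s.updates) *
          winnowRounds s₀ εhat η L m K T (Fin.tail S) (s'.skip s₀ (S 0)) _ ^ (t / (t + 1)) :=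
      ih (Fin.tail S) (s := s.skip s₀ (S 0)) hs hw' htilt hR'
    rcases lt_or_ge s.updates K with hk | hk
    · rw [winnowRounds_succ_of_lt hk hR, winnowRounds_succ_of_lt (s := s') hk hR]
      have := isProbabilityMeasure_aboveThresholdTest hε s.threshold (s.newErrors s₀ (S 0))
      have htilt' := htilt.updatedWeights hs hw' η (s.newCache s₀ (S 0))
      have hG := winnowUpdateLaw_le (s₀ := s₀) (εhat := εhat) (L := L) (K := K) (m := m) (S' := S)
        (s' := s') ht hs hw' htilt' hR'
        (c := tiltCost t (2 * η) m ^ (K - (s.updates + 1))) fun J =>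
          lintegral_le_of_forall_le_rpow ht hε (measurable_winnowRounds_update _ _ _ _ hR')
            fun θ => ih (Fin.tail S) (s := s.update s₀ η (S 0) J θ) (hs.updatedWeights η _)
              (hw'.updatedWeights η _) htilt' hR'
      rw [← pow_succ, show K - (s.updates + 1) + 1 = K - s.updates by omega] at hG
      refine (add_le_add (mul_le_mul_right hG _) (mul_le_mul_right hN _)).trans ?_
      rw [mul_left_comm, mul_left_comm (aboveThresholdTest εhat s.threshold _ {false}), ← mul_add]
      gcongr
      exact bool_mul_rpow_le _ h0 h1 _ _
    · rw [winnowRounds_succ_of_le hε hk hR, winnowRounds_succ_of_le (s := s') hε hk hR]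
      exact hN

/-- In the `AboveThreshold` instance in which the examples differ, raising the threshold by one
compensates for a difference of at most one between the numbers of errors. -/
theorem winnowRounds_succ_le_of_threshold_eq (ht : 0 < t) (hε : 0 < εhat) (hη : 0 ≤ η) {T : ℕ}
    {S S' : Fin (T + 1) → LabeledExample d} {s s' : WinnowState d}
    (hs : IsPositiveWeights s.weights) (hw : s'.weights = s.weights)
    (hh : s'.hypothesis = s.hypothesis) (hu : s'.updates = s.updates)
    (hθ : s'.threshold = s.threshold + 1) (htail : Fin.tail S' = Fin.tail S)
    (hq : |(s.newErrors s₀ (S 0) : ℝ) - s'.newErrors s₀ (S' 0)| ≤ 1)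
    {R : Set (Fin (T + 1) → Fin d → ℝ)} (hR : MeasurableSet R)
    (ih : winnowRounds s₀ εhat η L m K T (Fin.tail S) (s.skip s₀ (S 0))
        (prependHypothesis s.hypothesis ⁻¹' R) ≤
      ENNReal.ofReal (Real.exp (εhat / 2)) * tiltCost t (2 * η) m ^ (K - s.updates) *
        winnowRounds s₀ εhat η L m K T (Fin.tail S) (s'.skip s₀ (S' 0))
          (prependHypothesis s.hypothesis ⁻¹' R) ^ (t / (t + 1))) :
    winnowRounds s₀ εhat η L m K (T + 1) S s R ≤
      ENNReal.ofReal (Real.exp (εhat / 2)) * tiltCost t (2 * η) m ^ (K - s.updates) *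
        winnowRounds s₀ εhat η L m K (T + 1) S' s' R ^ (t / (t + 1)) := by
  obtain ⟨h0, h1⟩ := div_add_one_mem_Ioo ht
  have hR' := measurable_prependHypothesis s.hypothesis hR
  rcases lt_or_ge s.updates K with hk | hk
  · rw [winnowRounds_succ_of_lt hk hR, winnowRounds_succ_of_lt (hu ▸ hk) hR, hh, htail]
    have := isProbabilityMeasure_aboveThresholdTest hε s'.threshold (s'.newErrors s₀ (S' 0))
    have hs' : IsPositiveWeights s'.weights := hw ▸ hs
    have htilt : IsTiltOf (2 * η) (updatedWeights η s.weights (s.newCache s₀ (S 0)))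
        (updatedWeights η s'.weights (s'.newCache s₀ (S' 0))) :=
      hw ▸ isTiltOf_updatedWeights hs hη _ _
    have hG := winnowUpdateLaw_le (s₀ := s₀) (εhat := εhat) (L := L) (K := K) (m := m) (S := S)
      (S' := S') ht hs hs' htilt hR'
      (c := tiltCost t (2 * η) m ^ (K - (s.updates + 1))) fun J =>
        lintegral_le_of_forall_le_rpow ht hε (measurable_winnowRounds_update _ _ _ _ hR')
          fun θ => by
            have := winnowRounds_le_of_isTiltOf (s₀ := s₀) (εhat := εhat) (L := L) (m := m) (K := K)
              ht hε (Fin.tail S) (s := s.update s₀ η (S 0) J θ) (hs.updatedWeights η _)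
              (hs'.updatedWeights η _) htilt hR'
            have e : s'.update s₀ η (S' 0) J θ = { s.update s₀ η (S 0) J θ with
                weights := updatedWeights η s'.weights (s'.newCache s₀ (S' 0)) } := by
              simp [WinnowState.update, hu]
            rw [htail, e]
            exact this
    rw [← pow_succ, show K - (s.updates + 1) + 1 = K - s.updates by omega] at hG
    rw [abs_le] at hq
    -- Since `θ' = θ + 1` and `|q - q'| ≤ 1`, the gap `θ - q` grows by an amount between `0` and
    -- `2`. Passing therefore costs `exp (εhat / 2)`, once, because the bound `hG` for the runs
    -- after the update carries no such factor; failing is free, and there the factor comes from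
    -- `ih`.
    have hT := aboveThresholdTest_true_le hε (θ := s.threshold) (θ' := s'.threshold)
      (q := s.newErrors s₀ (S 0)) (q' := s'.newErrors s₀ (S' 0)) (by linarith)
    have hF := aboveThresholdTest_false_mono εhat (θ := s.threshold) (θ' := s'.threshold)
      (q := s.newErrors s₀ (S 0)) (q' := s'.newErrors s₀ (S' 0)) (by linarith)
    refine (add_le_add (mul_le_mul' hT hG) (mul_le_mul' hF ih)).trans ?_
    refine le_trans (le_of_eq ?_) (mul_le_mul_right (bool_mul_rpow_le _ h0 h1 _ _) _)
    ring
  · rw [winnowRounds_succ_of_le hε hk hR, winnowRounds_succ_of_le hε (hu ▸ hk) hR, hh, htail]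
    exact ih

/-- This covers the rest of the affected instance. Equal hypotheses err on the same examples, so the
difference of the error counts stays constant; the caches may differ arbitrarily. -/
theorem winnowRounds_le_of_threshold_eq (ht : 0 < t) (hε : 0 < εhat) (hη : 0 ≤ η) {T : ℕ}
    (S : Fin T → LabeledExample d) {s s' : WinnowState d}
    (hs : IsPositiveWeights s.weights) (hw : s'.weights = s.weights)
    (hh : s'.hypothesis = s.hypothesis) (hu : s'.updates = s.updates)
    (hθ : s'.threshold = s.threshold + 1) (hq : |(s.errors : ℝ) - s'.errors| ≤ 1)
    {R : Set (Fin T → Fin d → ℝ)} (hR : MeasurableSet R) :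
    winnowRounds s₀ εhat η L m K T S s R ≤
      ENNReal.ofReal (Real.exp (εhat / 2)) * tiltCost t (2 * η) m ^ (K - s.updates) *
        winnowRounds s₀ εhat η L m K T S s' R ^ (t / (t + 1)) := by
  induction T generalizing s s' with
  | zero =>
    have h1 := one_le_tiltCost ht (2 * η) m
    simp only [winnowRounds, Measure.dirac_apply' _ hR, Set.indicator]
    split_ifs
    · simpa using one_le_mul (ENNReal.one_le_ofReal.2 (Real.one_le_exp (by positivity)))
        (one_le_pow₀ h1)
    · simp
  | succ T ih =>
    have hq' : |(s.newErrors s₀ (S 0) : ℝ) - s'.newErrors s₀ (S 0)| ≤ 1 := by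
      simp only [WinnowState.newErrors]
      split_ifs with h h' h'
      · push_cast
        rwa [add_sub_add_right_eq_sub]
      · exact absurd (hh ▸ h) h'
      · exact absurd (hh ▸ h') h
      · exact hq
    exact winnowRounds_succ_le_of_threshold_eq ht hε hη hs hw hh hu hθ rfl hq' hR
      (ih (Fin.tail S) (s := s.skip s₀ (S 0)) (s' := s'.skip s₀ (S 0)) hs hw hh hu hθ hq'
        (measurable_prependHypothesis s.hypothesis hR))

/-- The weight `u` records the probability, given `θ`, that all earlier tests of the open instance
failed. It lets the integral over `θ` be postponed until the differing example, where the threshold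
is shifted. Monotonicity is what the shift requires: `u θ ≤ u (θ + 1)`. -/
theorem lintegral_winnowRounds_le (ht : 0 < t) (hε : 0 < εhat) (hη : 0 ≤ η) {T : ℕ}
    {S S' : Fin T → LabeledExample d} {i : Fin T} (hS : ∀ j, j ≠ i → S j = S' j)
    {s : WinnowState d} (hs : IsPositiveWeights s.weights) {u : ℝ → ENNReal} (hu : Monotone u)
    {R : Set (Fin T → Fin d → ℝ)} (hR : MeasurableSet R) :
    ∫⁻ θ, u θ * winnowRounds s₀ εhat η L m K T S { s with threshold := θ } R
        ∂aboveThresholdInit εhat L ≤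
      ENNReal.ofReal (Real.exp εhat) * tiltCost t (2 * η) m ^ (K - s.updates) *
        ∫⁻ θ, u θ * winnowRounds s₀ εhat η L m K T S' { s with threshold := θ } R ^ (t / (t + 1))
          ∂aboveThresholdInit εhat L := by
  obtain ⟨h0, h1⟩ := div_add_one_mem_Ioo ht
  induction T generalizing s u with
  | zero => exact i.elim0
  | succ T ih =>
    have hR' := measurable_prependHypothesis s.hypothesis hR
    rcases Fin.eq_zero_or_eq_succ i with rfl | ⟨i, rfl⟩
    · have htail : Fin.tail S' = Fin.tail S :=
        funext fun j => (hS j.succ (Fin.succ_ne_zero j)).symm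
      have hE : ENNReal.ofReal (Real.exp εhat) =
          ENNReal.ofReal (Real.exp (εhat / 2)) * ENNReal.ofReal (Real.exp (εhat / 2)) := by
        rw [← ENNReal.ofReal_mul (Real.exp_pos _).le, ← Real.exp_add, add_halves]
      have hq : |(s.newErrors s₀ (S 0) : ℝ) - s.newErrors s₀ (S' 0)| ≤ 1 := by
        simp only [WinnowState.newErrors]
        split_ifs <;> simp
      have hpt : ∀ θ, winnowRounds s₀ εhat η L m K (T + 1) S { s with threshold := θ } R ≤
          ENNReal.ofReal (Real.exp (εhat / 2)) * tiltCost t (2 * η) m ^ (K - s.updates) *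
            winnowRounds s₀ εhat η L m K (T + 1) S' { s with threshold := θ + 1 } R ^
              (t / (t + 1)) := fun θ =>
        winnowRounds_succ_le_of_threshold_eq (s := { s with threshold := θ })
          (s' := { s with threshold := θ + 1 }) ht hε hη hs rfl rfl rfl rfl htail hq hR
          (winnowRounds_le_of_threshold_eq (s := { s with threshold := θ }.skip s₀ (S 0))
            (s' := { s with threshold := θ + 1 }.skip s₀ (S' 0)) ht hε hη (Fin.tail S) hs
            rfl rfl rfl rfl hq hR')
      set f : ℝ → ENNReal := fun θ => u θ *
        winnowRounds s₀ εhat η L m K (T + 1) S' { s with threshold := θ } R ^ (t / (t + 1))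
      have hf : Measurable f :=
        hu.measurable.mul ((measurable_winnowRounds_apply S' s hR).pow_const _)
      have hf' : Measurable fun θ => f (θ + 1) := hf.comp (measurable_add_const 1)
      -- One factor `exp (εhat / 2)` comes from the pointwise comparison `hpt`, the other from
      -- translating the law of `θ` back by one.
      calc _ ≤ ∫⁻ θ, ENNReal.ofReal (Real.exp (εhat / 2)) *
            tiltCost t (2 * η) m ^ (K - s.updates) * f (θ + 1) ∂aboveThresholdInit εhat L := by
            refine lintegral_mono fun θ => ?_
            refine (mul_le_mul' (hu (le_add_of_nonneg_right zero_le_one)) (hpt θ)).trans_eq ?_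
            rw [mul_left_comm]
        _ ≤ _ := by
            rw [lintegral_const_mul _ hf', hE]
            refine (mul_le_mul_right
              (lintegral_aboveThresholdInit_comp_add_one_le hε L hf) _).trans_eq ?_
            ring
    · have hS0 : S 0 = S' 0 := hS 0 (Fin.succ_ne_zero i).symm
      have ih' := fun {s : WinnowState d} (hs : IsPositiveWeights s.weights) {u : ℝ → ENNReal}
          (hu : Monotone u) {R : Set (Fin T → Fin d → ℝ)} (hR : MeasurableSet R) =>
        ih (S := Fin.tail S) (S' := Fin.tail S') (i := i)
          (fun j hj => hS j.succ fun h => hj (Fin.succ_injective _ h)) (s := s) hs (u := u) hu hR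
      have hN := fun {u : ℝ → ENNReal} (hu : Monotone u) =>
        ih' (s := s.skip s₀ (S 0)) hs (u := u) hu hR'
      rcases lt_or_ge s.updates K with hk | hk
      · have hG : winnowUpdateLaw s₀ εhat η L m K T S s (prependHypothesis s.hypothesis ⁻¹' R) ≤
            ENNReal.ofReal (Real.exp εhat) * tiltCost t (2 * η) m ^ (K - s.updates) *
            winnowUpdateLaw s₀ εhat η L m K T S' s (prependHypothesis s.hypothesis ⁻¹' R) ^
              (t / (t + 1)) := by
          -- Both runs use the same weights here, so charging a `tiltCost` is wasteful but harmless.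
          -- The fresh instance starts the induction again with `u = 1`, and the `0` passed as
          -- threshold is overwritten.
          have := winnowUpdateLaw_le (s₀ := s₀) (εhat := εhat) (L := L) (K := K) (m := m) (S := S)
            (S' := S') ht hs hs (isTiltOf_updatedWeights hs hη _ _) hR'
            (c := ENNReal.ofReal (Real.exp εhat) *
              tiltCost t (2 * η) m ^ (K - (s.updates + 1))) fun J => by
              rw [← hS0]
              have h := ih' (s := s.update s₀ η (S 0) J 0) (hs.updatedWeights η _)
                (u := fun _ => 1) monotone_const hR'
              simp only [one_mul] at h
              have := isProbabilityMeasure_aboveThresholdInit hε L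
              refine h.trans (mul_le_mul_right (lintegral_rpow_le_rpow_lintegral _ h0 h1 ?_) _)
              exact (measurable_winnowRounds_apply _ _ hR').aemeasurable
          rwa [mul_assoc (ENNReal.ofReal _), ← pow_succ,
            show K - (s.updates + 1) + 1 = K - s.updates by omega] at this
        set C := ENNReal.ofReal (Real.exp εhat) * tiltCost t (2 * η) m ^ (K - s.updates)
        set G := winnowUpdateLaw s₀ εhat η L m K T S s (prependHypothesis s.hypothesis ⁻¹' R)
        set G' := winnowUpdateLaw s₀ εhat η L m K T S' s (prependHypothesis s.hypothesis ⁻¹' R)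
        set N := fun θ => winnowRounds s₀ εhat η L m K T (Fin.tail S)
          { s.skip s₀ (S 0) with threshold := θ } (prependHypothesis s.hypothesis ⁻¹' R)
        set N' := fun θ => winnowRounds s₀ εhat η L m K T (Fin.tail S')
          { s.skip s₀ (S 0) with threshold := θ } (prependHypothesis s.hypothesis ⁻¹' R)
        set A := fun θ => aboveThresholdTest εhat θ (s.newErrors s₀ (S 0)) {true} with hA
        set B := fun θ => aboveThresholdTest εhat θ (s.newErrors s₀ (S 0)) {false} with hB
        have hAm : Measurable A := measurable_aboveThresholdTest _ _ _
        have hBm : Monotone B := fun θ θ' h => aboveThresholdTest_false_mono _ (by linarith)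
        have hN'm : Measurable N' := measurable_winnowRounds_apply _ _ hR'
        have e : ∀ θ, winnowRounds s₀ εhat η L m K (T + 1) S { s with threshold := θ } R =
            A θ * G + B θ * N θ := fun θ =>
          winnowRounds_succ_of_lt (s := { s with threshold := θ }) hk hR
        have e' : ∀ θ, winnowRounds s₀ εhat η L m K (T + 1) S' { s with threshold := θ } R =
            A θ * G' + B θ * N' θ := fun θ => by
          have := winnowRounds_succ_of_lt (s₀ := s₀) (εhat := εhat) (η := η) (L := L) (m := m)
            (S := S') (s := { s with threshold := θ }) hk hR
          rw [← hS0] at this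
          exact this
        -- A failing test is absorbed into the weight, which stays monotone. The passing probability
        -- `A` is antitone and could not be, but it multiplies `G`, which does not depend on `θ`.
        have hBN := hN (u := fun θ => u θ * B θ) (hu.mul' hBm)
        have hmA : Measurable fun θ => u θ * A θ := hu.measurable.mul hAm
        have hmB : Measurable fun θ => u θ * B θ := hu.measurable.mul hBm.measurable
        calc _ = ∫⁻ θ, u θ * A θ * G ∂aboveThresholdInit εhat L +
              ∫⁻ θ, u θ * B θ * N θ ∂aboveThresholdInit εhat L := by
              rw [← lintegral_add_left (hmA.mul_const _)]
              refine lintegral_congr fun θ => ?_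
              rw [e]
              ring
          _ ≤ ∫⁻ θ, C * (u θ * A θ * G' ^ (t / (t + 1))) ∂aboveThresholdInit εhat L +
              C * ∫⁻ θ, u θ * B θ * N' θ ^ (t / (t + 1)) ∂aboveThresholdInit εhat L := by
              refine add_le_add (lintegral_mono fun θ => ?_) hBN
              rw [mul_left_comm C]
              exact mul_le_mul_right hG _
          _ = C * ∫⁻ θ, u θ * (A θ * G' ^ (t / (t + 1)) + B θ * N' θ ^ (t / (t + 1)))
              ∂aboveThresholdInit εhat L := by
              rw [lintegral_const_mul _ (hmA.mul_const _), ← mul_add,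
                ← lintegral_add_left (hmA.mul_const _)]
              simp only [mul_add, mul_assoc]
          _ ≤ _ := by
              gcongr with θ
              rw [e']
              have := isProbabilityMeasure_aboveThresholdTest hε θ (s.newErrors s₀ (S 0))
              exact bool_mul_rpow_le _ h0 h1 _ _
      · have e : ∀ θ, winnowRounds s₀ εhat η L m K (T + 1) S { s with threshold := θ } R =
            winnowRounds s₀ εhat η L m K T (Fin.tail S)
              { s.skip s₀ (S 0) with threshold := θ } (prependHypothesis s.hypothesis ⁻¹' R) :=
          fun θ => winnowRounds_succ_of_le (s := { s with threshold := θ }) hε hk hR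
        have e' : ∀ θ, winnowRounds s₀ εhat η L m K (T + 1) S' { s with threshold := θ } R =
            winnowRounds s₀ εhat η L m K T (Fin.tail S')
              { s.skip s₀ (S 0) with threshold := θ } (prependHypothesis s.hypothesis ⁻¹' R) :=
          fun θ => by
            rw [hS0]
            exact winnowRounds_succ_of_le (s := { s with threshold := θ }) hε hk hR
        simp only [e, e']
        exact hN hu

end Comparison

/-! ### Privacy of DP-Winnow -/

theorem isPositiveWeights_uniform {d : ℕ} (hd : 0 < d) :
    IsPositiveWeights fun _ : Fin d => 1 / (d : ℝ) :=
  ⟨fun _ => by positivity, by simp [hd.ne']⟩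

theorem isProbabilityMeasure_dpWinnow {d T m K : ℕ} (hd : 0 < d) (s₀ η L : ℝ) {εhat : ℝ}
    (hε : 0 < εhat) (S : Fin T → LabeledExample d) :
    IsProbabilityMeasure (dpWinnow s₀ εhat η L m K S) := by
  have := isProbabilityMeasure_aboveThresholdInit hε L
  exact isProbabilityMeasure_bind
    (measurable_winnowRounds_threshold _ _ _ _ _ _ _ _ _ fun θ => rfl).aemeasurable
    (Filter.Eventually.of_forall fun θ =>
      isProbabilityMeasure_winnowRounds _ _ _ hε _ _ _ _ (isPositiveWeights_uniform hd))

theorem dpWinnow_apply_le {d T m K : ℕ} (hd : 0 < d) {s₀ η L εhat t : ℝ} (ht : 0 < t)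
    (hε : 0 < εhat) (hη : 0 ≤ η) {S S' : Fin T → LabeledExample d} (hS : Neighboring S S')
    {R : Set (Fin T → Fin d → ℝ)} (hR : MeasurableSet R) :
    dpWinnow s₀ εhat η L m K S R ≤
      ENNReal.ofReal (Real.exp εhat) * tiltCost t (2 * η) m ^ K *
        dpWinnow s₀ εhat η L m K S' R ^ (t / (t + 1)) := by
  obtain ⟨i, hi⟩ := hS
  have hm := fun S : Fin T → LabeledExample d =>
    measurable_winnowRounds_threshold s₀ εhat η L m K T S
      (fun θ => ⟨fun _ => 1 / (d : ℝ), fun _ => 1 / (d : ℝ), [], 0, 0, θ⟩) fun θ => rfl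
  rw [dpWinnow, dpWinnow, Measure.bind_apply hR (hm S).aemeasurable,
    Measure.bind_apply hR (hm S').aemeasurable]
  have h := lintegral_winnowRounds_le (s₀ := s₀) (L := L) (m := m) (K := K) ht hε hη hi
    (s := ⟨fun _ => 1 / (d : ℝ), fun _ => 1 / (d : ℝ), [], 0, 0, 0⟩)
    (isPositiveWeights_uniform hd) (u := fun _ => 1) monotone_const hR
  simp only [one_mul, Nat.sub_zero] at h
  have := isProbabilityMeasure_aboveThresholdInit hε L
  obtain ⟨h0, h1⟩ := div_add_one_mem_Ioo ht
  refine h.trans (mul_le_mul_right (lintegral_rpow_le_rpow_lintegral _ h0 h1 ?_) _)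
  exact ((Measure.measurable_coe hR).comp (hm S')).aemeasurable

/-! ### From the power bound to `(ε, δ)` -/

theorem exp_mul_rpow_le {a x ε δ t : ℝ} (ht : 0 < t) (hx : 0 ≤ x) (hδ : 0 < δ)
    (ha : a + Real.log (1 / δ) / (t + 1) ≤ ε * (t / (t + 1))) :
    Real.exp a * x ^ (t / (t + 1)) ≤ Real.exp ε * x + δ := by
  have e : 1 / (t + 1) = 1 - t / (t + 1) := by field_simp; ring
  have h1 : Real.exp a ≤ Real.exp ε ^ (t / (t + 1)) * δ ^ (1 / (t + 1)) := by
    rw [← Real.exp_mul, Real.rpow_def_of_pos hδ, ← Real.exp_add, Real.exp_le_exp]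
    rw [one_div, Real.log_inv] at ha
    rw [one_div, ← div_eq_mul_inv]
    rw [neg_div] at ha
    linarith
  -- By `h1` the left side is at most a weighted geometric mean of `exp ε * x` and `δ`, hence at
  -- most their weighted arithmetic mean.
  have h2 := Real.geom_mean_le_arith_mean2_weighted (w₁ := t / (t + 1)) (w₂ := 1 / (t + 1))
    (p₁ := Real.exp ε * x) (p₂ := δ) (by positivity) (by positivity) (by positivity) hδ.le
    (by field_simp)
  have h3 : t / (t + 1) * (Real.exp ε * x) ≤ 1 * (Real.exp ε * x) := by
    gcongr
    exact (div_add_one_mem_Ioo ht).2.le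
  have h4 : 1 / (t + 1) * δ ≤ 1 * δ := by
    gcongr
    rw [div_le_one (by positivity)]
    linarith
  calc _ ≤ Real.exp ε ^ (t / (t + 1)) * δ ^ (1 / (t + 1)) * x ^ (t / (t + 1)) := by gcongr
    _ = (Real.exp ε * x) ^ (t / (t + 1)) * δ ^ (1 / (t + 1)) := by
      rw [Real.mul_rpow (Real.exp_pos _).le hx]
      ring
    _ ≤ _ := by linarith

theorem tiltCost_pow {t : ℝ} (ht : 0 < t) (a : ℝ) (m K : ℕ) :
    tiltCost t a m ^ K = ENNReal.ofReal (Real.exp (m * K * t * a ^ 2 / 2)) := by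
  rw [tiltCost, ENNReal.ofReal_rpow_of_pos (by positivity),
    ← ENNReal.ofReal_pow (by positivity), ← Real.exp_nat_mul, ← Real.exp_mul, ← Real.exp_nat_mul]
  congr 2
  field_simp

theorem mainTheorem3 (d T m K : ℕ) (hd : 0 < d) (hm : 0 < m) (hK : 0 < K)
    (s₀ L ε δ εhat η : ℝ) (hε : ε ∈ Set.Ioo (0 : ℝ) 1) (hδ : δ ∈ Set.Ioo (0 : ℝ) 1)
    (hεhat : εhat = ε / (4 * Real.sqrt (2 * (K : ℝ) * Real.log (2 / δ))))
    (hη : η = ε / (8 * Real.sqrt (2 * (m : ℝ) * (K : ℝ) * Real.log (2 / δ)))) :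
    (∀ S : Fin T → LabeledExample d,
      IsProbabilityMeasure (dpWinnow s₀ εhat η L m K S)) ∧
    IsDifferentiallyPrivate
      (fun S : Fin T → LabeledExample d => dpWinnow s₀ εhat η L m K S) ε δ := by
  obtain ⟨hε0, hε1⟩ := hε
  obtain ⟨hδ0, hδ1⟩ := hδ
  have hl : Real.log 2 ≤ Real.log (2 / δ) := by
    apply Real.log_le_log two_pos
    rw [le_div_iff₀ hδ0]
    linarith
  have hl2 := Real.log_two_gt_d9
  have hlδ : Real.log (1 / δ) ≤ Real.log (2 / δ) :=
    Real.log_le_log (by positivity) (by gcongr; norm_num)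
  set l := Real.log (2 / δ)
  have hl0 : 0 < l := by linarith
  have hm1 : (1 : ℝ) ≤ m := by exact_mod_cast hm
  have hK1 : (1 : ℝ) ≤ K := by exact_mod_cast hK
  have hεhat0 : 0 < εhat := by rw [hεhat]; positivity
  have hη0 : 0 ≤ η := by rw [hη]; positivity
  have hprob := isProbabilityMeasure_dpWinnow (T := T) (m := m) (K := K) hd s₀ η L hεhat0
  refine ⟨hprob, fun S S' hS R => ?_⟩
  have hεhat1 : εhat ≤ ε / 4 := by
    rw [hεhat]
    gcongr
    have : (1 : ℝ) ≤ Real.sqrt (2 * K * l) := by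
      rw [Real.one_le_sqrt]
      nlinarith
    linarith
  have hη2 : (m : ℝ) * K * η ^ 2 = ε ^ 2 / (128 * l) := by
    rw [hη, div_pow, mul_pow, Real.sq_sqrt (by positivity)]
    field_simp
    norm_num
  -- With this `t` the three costs are at most `ε / 4` (AboveThreshold), `ε / 8` (sampling) and `ε /
  -- 8` (the `δ` term). Their sum `ε / 2` is at most `ε * t / (t + 1)` as soon as `t ≥ 1`.
  set t := 8 * l / ε with ht_def
  have ht : 0 < t := by positivity
  have ht5 : 5 ≤ t := by
    rw [ht_def, le_div_iff₀ hε0]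
    nlinarith
  have hbudget : εhat + m * K * t * (2 * η) ^ 2 / 2 + Real.log (1 / δ) / (t + 1) ≤
      ε * (t / (t + 1)) := by
    have h1 : (m : ℝ) * K * t * (2 * η) ^ 2 / 2 = ε / 8 := by
      rw [show (m : ℝ) * K * t * (2 * η) ^ 2 / 2 = 2 * t * (m * K * η ^ 2) by ring, hη2, ht_def]
      field_simp
      norm_num
    have h2 : Real.log (1 / δ) / (t + 1) ≤ ε / 8 := by
      rw [div_le_iff₀ (by positivity)]
      have : ε / 8 * t = l := by rw [ht_def]; field_simp
      nlinarith
    have h3 : ε * (1 / 2) ≤ ε * (t / (t + 1)) := by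
      gcongr ε * ?_
      rw [div_le_div_iff₀ two_pos (by positivity)]
      linarith
    linarith
  -- The set `R` is arbitrary. Its measurable hull for the law on `S'` keeps the right side
  -- unchanged and can only enlarge the left side.
  set R' := toMeasurable (dpWinnow s₀ εhat η L m K S') R
  have hR' : MeasurableSet R' := measurableSet_toMeasurable _ _
  have key := dpWinnow_apply_le (s₀ := s₀) (L := L) (m := m) (K := K) hd ht hεhat0 hη0 hS hR'
  have := hprob S'
  have hx : dpWinnow s₀ εhat η L m K S' R' = ENNReal.ofReal ((dpWinnow s₀ εhat η L m K S').real R') :=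
    (ofReal_measureReal).symm
  rw [tiltCost_pow ht, ← ENNReal.ofReal_mul (Real.exp_pos _).le, ← Real.exp_add, hx,
    ENNReal.ofReal_rpow_of_nonneg measureReal_nonneg (by positivity),
    ← ENNReal.ofReal_mul (Real.exp_pos _).le] at key
  calc dpWinnow s₀ εhat η L m K S R ≤ dpWinnow s₀ εhat η L m K S R' :=
        measure_mono (subset_toMeasurable _ _)
    _ ≤ _ := key
    _ ≤ ENNReal.ofReal (Real.exp ε * (dpWinnow s₀ εhat η L m K S').real R' + δ) :=
        ENNReal.ofReal_le_ofReal (exp_mul_rpow_le ht measureReal_nonneg hδ0 hbudget)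
    _ = _ := by
        rw [ENNReal.ofReal_add (by positivity) hδ0.le, ENNReal.ofReal_mul (Real.exp_pos _).le, ← hx,
          measure_toMeasurable]
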